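/- Let $F$ be a field of characteristic $0$, let $n\ge 2$, and let $L$ be a finite-dimensional $n$-ary algebra over $F$, that is, a finite-dimensional $F$-space with an $n$-linear multiplication $[\cdot,\dots,\cdot]:L^n\to L$. Call $L$ commutative if $[x_{\sigma(1)},\dots,x_{\sigma(n)}]=[x_1,\dots,x_n]$, and anticommutative if $[x_{\sigma(1)},\dots,x_{\sigma(n)}]=\operatorname{sgn}(\sigma)[x_1,\dots,x_n]$, for all $\sigma\in S_n$ and all $x_i\in L$; call it a Filippov algebra if it is anticommutative and $$[[x_1,\dots,x_n],y_2,\dots,y_n]=\sum_{i=1}^n[x_1,\dots,[x_i,y_2,\dots,y_n],\dots,x_n].$$ Let $QDer_{KS}(L)$ be the space of all $d\in End(L)$ for which there is an $f\in End(L)$ with $$d([a_1,\dots,a_n])=\sum_{i=1}^n[a_1,\dots,a_{i-1},f(a_i),a_{i+1},\dots,a_n]\quad\text{for all }a_1,\dots,a_n\in L,$$ where $End(L)$ is the space of all linear maps $L\to L$. Consider the following $n$-ary algebras over $F$. * $L_\alpha$ ($\alpha\in F$): one-dimensional, spanned by $v$, with $[v,\dots,v]=\alpha v$. * $A_n$: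 anticommutative with basis $e_1,\dots,e_n$ and $[e_1,\dots,e_n]=e_1$. * $L_B$, for an $(n+1)\times(n+1)$ matrix $B=(\beta_{ij})$ over $F$: anticommutative with basis $e_1,\dots,e_{n+1}$ and $(-1)^{n+i+1}[e_1,\dots,\widehat{e_i},\dots,e_{n+1}]=\beta_{1i}e_1+\dots+\beta_{n+1,i}e_{n+1}$ for $i=1,\dots,n+1$. * $D_{n+1}=L_I$, where $I$ is the identity matrix. **Theorem 4.9.** 1. Let $L$ be commutative. Then $QDer_{KS}(L)=End(L)$ if and only if $L$ has zero product or $L\cong L_\alpha$ for some nonzero $\alpha\in F$. Moreover, if $QDer_{KS}(L)=End(L)$, the product of $L$ is nonzero and $F$ is algebraically closed, then there is a bilinear multiplication $\cdot$ on $L$ such that $(L,\cdot)\cong F$ as $F$-algebras and $[x_1,\dots,x_n]=x_1\cdot\ldots\cdot x_n$ for all $x_1,\dots,x_n\in L$. 2. Let $L$ be anticommutative. Then $QDer_{KS}(L)=End(L)$ if and only if $L$ has zero product or $L\cong L_B$ for some nondegenerate $(n+1)\times(n+1)$ matrix $B$. Moreover, if $QDer_{KS}(L)=End(L)$, the product of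 $L$ is nonzero, $L$ is a Filippov algebra and $F$ is algebraically closed, then $L\cong D_{n+1}$. 3. In particular, $QDer_{KS}(L_B)=End(L_B)$ for every nondegenerate $B$, whereas $QDer_{KS}(A_n)\ne End(A_n)$. -/

import Mathlib

namespace NaryAlg

/-- An `n`-ary algebra structure on the `F`-space `L`: an `n`-linear multiplication
`(x₁, …, xₙ) ↦ [x₁, …, xₙ]` on `L`. -/
abbrev Bracket (F : Type*) [Field F] (L : Type*) [AddCommGroup L] [Module F L] (n : ℕ) :=
  MultilinearMap F (fun _ : Fin n => L) L

section Basic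

variable {F : Type*} [Field F] {L : Type*} [AddCommGroup L] [Module F L]
  {M : Type*} [AddCommGroup M] [Module F M] {n : ℕ}

/-- `[x_{σ(1)}, …, x_{σ(n)}] = [x₁, …, xₙ]` for all permutations `σ`. -/
def IsCommutative (μ : Bracket F L n) : Prop :=
  ∀ (σ : Equiv.Perm (Fin n)) (x : Fin n → L), μ (fun i => x (σ i)) = μ x

/-- `[x_{σ(1)}, …, x_{σ(n)}] = sgn(σ) [x₁, …, xₙ]` for all permutations `σ`. -/
def IsAnticommutative (μ : Bracket F L n) : Prop :=
  ∀ (σ : Equiv.Perm (Fin n)) (x : Fin n → L),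
    μ (fun i => x (σ i)) = (Equiv.Perm.sign σ : ℤ) • μ x

/-- Filippov (`n`-Lie) algebras: anticommutative with
`[[x₁, …, xₙ], y₂, …, yₙ] = ∑ᵢ [x₁, …, [xᵢ, y₂, …, yₙ], …, xₙ]`.
The entry `y 0` is always overwritten, so only `y₂, …, yₙ` play a role. -/
def IsFilippov [NeZero n] (μ : Bracket F L n) : Prop :=
  IsAnticommutative μ ∧
    ∀ x y : Fin n → L,
      μ (Function.update y 0 (μ x)) =
        ∑ i, μ (Function.update x i (μ (Function.update y 0 (x i))))

/-- Isomorphism of `n`-ary algebras. -/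
def Iso (μ : Bracket F L n) (ν : Bracket F M n) : Prop :=
  ∃ φ : L ≃ₗ[F] M, ∀ x : Fin n → L, φ (μ x) = ν (fun i => φ (x i))

/-- The space of quasiderivations: pairs `(d, f)` of linear maps with
`d [a₁, …, aₙ] = ∑ᵢ [a₁, …, f aᵢ, …, aₙ]`. -/
def QDer (μ : Bracket F L n) : Submodule F (Module.End F L × Module.End F L) where
  carrier := {p | ∀ a : Fin n → L, p.1 (μ a) = ∑ i, μ (Function.update a i (p.2 (a i)))}
  zero_mem' := by
    intro a
    simp only [Prod.fst_zero, Prod.snd_zero, LinearMap.zero_apply]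
    exact (Finset.sum_eq_zero fun i _ => μ.map_coord_zero i (by simp)).symm
  add_mem' := by
    intro p q hp hq a
    simp only [Prod.fst_add, Prod.snd_add, LinearMap.add_apply, MultilinearMap.map_update_add,
      Finset.sum_add_distrib]
    rw [hp a, hq a]
  smul_mem' := by
    intro c p hp a
    simp only [Prod.smul_fst, Prod.smul_snd, LinearMap.smul_apply, MultilinearMap.map_update_smul,
      ← Finset.smul_sum]
    rw [hp a]

/-- Quasiderivations in the sense of Kaygorodov and Shestakov: the first components `d` of the
quasiderivations `(d, f)`. -/
def QDerKS (μ : Bracket F L n) : Submodule F (Module.End F L) :=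
  (QDer μ).map (LinearMap.fst F (Module.End F L) (Module.End F L))

/-- The left-normed product `(⋯((x₁ · x₂) · x₃) ⋯) · xₙ` of a nonempty list with respect to a
binary multiplication `m` (the value `0` at the empty list is never used). -/
def leftProd (m : L →ₗ[F] L →ₗ[F] L) : List L → L
  | [] => 0
  | a :: l => l.foldl (fun u v => m u v) a

end Basic

section Examples

variable {F : Type*} [Field F]

/-- The one-dimensional `n`-ary algebra `L_α`, realized on `F`: `[x₁, …, xₙ] = α x₁ ⋯ xₙ`, so
`[v, …, v] = α v` for `v = 1`. -/
def LAlpha (n : ℕ) (α : F) : Bracket F F n :=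
  α • MultilinearMap.mkPiAlgebra F (Fin n) F

/-- The `n`-dimensional anticommutative algebra `A_n` on `Fⁿ`: `[x₁, …, xₙ] = det(x₁, …, xₙ) e₁`,
so `[e₁, …, eₙ] = e₁`. -/
def An (F : Type*) [Field F] (n : ℕ) [NeZero n] : Bracket F (Fin n → F) n :=
  (Matrix.detRowAlternating : (Fin n → F) [⋀^Fin n]→ₗ[F] F).toMultilinearMap.smulRight
    (Pi.single 0 1)

/-- For vectors `x₁, …, xₙ` of `F^{n+1}`, the determinant of the `n × n` matrix whose rows are the
`x_k` with the `i`-th coordinate deleted. -/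
def minor (n : ℕ) (i : Fin (n + 1)) : MultilinearMap F (fun _ : Fin n => Fin (n + 1) → F) F :=
  (Matrix.detRowAlternating : (Fin n → F) [⋀^Fin n]→ₗ[F] F).toMultilinearMap.compLinearMap
    (fun _ => LinearMap.funLeft F F i.succAbove)

/-- The `(n+1)`-dimensional anticommutative algebra `L_B` on `F^{n+1}`, with standard basis
`e₁, …, e_{n+1}`. Its multiplication is determined by
`(-1)^{n+i+1} [e₁, …, êᵢ, …, e_{n+1}] = ∑ⱼ B j i • eⱼ` for `i = 1, …, n+1`, that is, by the `i`-th
column of `B`. (Here `i` starts from `0`, so the exponent `n + i + 1` becomes `n + i` up to an even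
number.) -/
def LB (n : ℕ) (B : Matrix (Fin (n + 1)) (Fin (n + 1)) F) : Bracket F (Fin (n + 1) → F) n :=
  ∑ i : Fin (n + 1), ((-1 : F) ^ (n + (i : ℕ))) • (minor n i).smulRight (fun j => B j i)

/-- The algebra `D_{n+1} = L_I`: `[e₁, …, êᵢ, …, e_{n+1}] = (-1)^{n+i+1} eᵢ` (with `i` from `1`). -/
def D (F : Type*) [Field F] (n : ℕ) : Bracket F (Fin (n + 1) → F) n :=
  LB n (1 : Matrix (Fin (n + 1)) (Fin (n + 1)) F)

end Examples

end NaryAlg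

namespace NaryAlg

open Module

/-! Suppose every `d` occurs and the product is nonzero. Products then span `L`, so `f` determines
`d`, and a dimension count shows that every `f` occurs too (`exists_left`). Matrix units as `f`
carry a vanishing product of basis vectors to other products, so no basis product vanishes (with
distinct entries, in the anticommutative case). Diagonal `f` make these products eigenvectors of
`d`, so at most `dim L` weights occur (`card_le_of_weights`). This forces dimension 1 in the
commutative case. In the anticommutative case the `n`-subsets of a basis can be given distinct
weights, so `choose m n ≤ m` for `m = dim L`; hence `m = n + 1`, as for `m = n` the products span
only a line.

In dimension `n + 1` the product is a matrix `B` applied to the cross product `D`, and `∑ D(…, A xᵢ,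
…) = (tr A - Aᵀ) D(x)` (`sum_D_update`). For invertible `B`, any `d` is reached by solving `tr A -
Aᵀ = B⁻¹ d B`. The Filippov identity says that the multiplications `B R`, with `R` skew, are
derivations; the same formula then makes `B` symmetric. Over an algebraically closed field `B = Q
Qᵀ`, and a multiple of `Q` is an isomorphism from `D` to `L_B`. -/

lemma comp_update_apply {ι α β : Type*} [DecidableEq ι] (φ : α → β) (a : ι → α) (i : ι) (z : α) :
    (fun j => φ (Function.update a i z j)) = Function.update (fun j => φ (a j)) i (φ z) :=
  Function.comp_update φ a i z

/-! ### Quasiderivations of arbitrary `n`-ary algebras -/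

section General

variable {F : Type*} [Field F] {L : Type*} [AddCommGroup L] [Module F L]
  {M : Type*} [AddCommGroup M] [Module F M] {N : Type*} [AddCommGroup N] [Module F N] {n : ℕ}

lemma mem_QDerKS {μ : Bracket F L n} {d : End F L} :
    d ∈ QDerKS μ ↔ ∃ f : End F L, ∀ a : Fin n → L,
      d (μ a) = ∑ i, μ (Function.update a i (f (a i))) := by
  constructor
  · rintro ⟨⟨d', f⟩, h, rfl⟩
    exact ⟨f, h⟩
  · rintro ⟨f, h⟩
    exact ⟨(d, f), h, rfl⟩

lemma QDerKS_eq_top_iff {μ : Bracket F L n} :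
    QDerKS μ = ⊤ ↔ ∀ d : End F L, ∃ f : End F L, ∀ a : Fin n → L,
      d (μ a) = ∑ i, μ (Function.update a i (f (a i))) := by
  simp only [Submodule.eq_top_iff', mem_QDerKS]

lemma QDerKS_zero : QDerKS (0 : Bracket F L n) = ⊤ :=
  QDerKS_eq_top_iff.2 fun d => ⟨0, fun a => by simp⟩

lemma Iso.symm {μ : Bracket F L n} {ν : Bracket F M n} (h : Iso μ ν) : Iso ν μ := by
  obtain ⟨φ, h⟩ := h
  refine ⟨φ.symm, fun x => ?_⟩
  rw [LinearEquiv.symm_apply_eq, h]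
  simp

lemma Iso.trans {μ : Bracket F L n} {ν : Bracket F M n} {ρ : Bracket F N n}
    (h : Iso μ ν) (h' : Iso ν ρ) : Iso μ ρ := by
  obtain ⟨φ, h⟩ := h
  obtain ⟨ψ, h'⟩ := h'
  exact ⟨φ.trans ψ, fun x => by simp [h, h']⟩

lemma Iso.QDerKS_eq_top {μ : Bracket F L n} {ν : Bracket F M n} (h : Iso μ ν)
    (hμ : QDerKS μ = ⊤) : QDerKS ν = ⊤ := by
  obtain ⟨φ, h⟩ := h
  rw [QDerKS_eq_top_iff] at hμ ⊢
  intro d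
  obtain ⟨f, hf⟩ := hμ (φ.symm.conj d)
  refine ⟨φ.conj f, fun a => ?_⟩
  have := congrArg φ (hf fun i => φ.symm (a i))
  simp only [map_sum, h, comp_update_apply] at this
  simpa [LinearEquiv.conj_apply, h] using this

lemma Iso.isAnticommutative {μ : Bracket F L n} {ν : Bracket F M n} (h : Iso μ ν)
    (hμ : IsAnticommutative μ) : IsAnticommutative ν := by
  obtain ⟨φ, h⟩ := h
  intro σ x
  have := congrArg φ (hμ σ fun i => φ.symm (x i))
  rw [map_zsmul, h, h] at this
  simpa using this

lemma Iso.isFilippov [NeZero n] {μ : Bracket F L n} {ν : Bracket F M n} (h : Iso μ ν)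
    (hμ : IsFilippov μ) : IsFilippov ν := by
  refine ⟨h.isAnticommutative hμ.1, fun x y => ?_⟩
  obtain ⟨φ, h⟩ := h
  have := congrArg φ (hμ.2 (fun i => φ.symm (x i)) (fun i => φ.symm (y i)))
  simp only [map_sum, h, comp_update_apply] at this
  simpa using this

lemma exists_iso (μ : Bracket F L n) (e : L ≃ₗ[F] M) : ∃ ν : Bracket F M n, Iso μ ν := by
  refine ⟨e.toLinearMap.compMultilinearMap
    (μ.compLinearMap fun _ => e.symm.toLinearMap), e, fun x => ?_⟩
  simp

/-- A rank-one `d` sends one nonzero product to any prescribed vector, and the defining identity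
writes that image as a sum of products. -/
lemma span_range_eq_top {μ : Bracket F L n} (hμ : QDerKS μ = ⊤) (h0 : μ ≠ 0) :
    Submodule.span F (Set.range μ) = ⊤ := by
  obtain ⟨a, ha⟩ : ∃ a, μ a ≠ 0 := by
    by_contra! h
    exact h0 (MultilinearMap.ext h)
  rw [Submodule.eq_top_iff']
  intro z
  obtain ⟨ψ, hψ⟩ := Module.Projective.exists_dual_eq_one F ha
  obtain ⟨f, hf⟩ := QDerKS_eq_top_iff.1 hμ (ψ.smulRight z)
  have hz := hf a
  rw [LinearMap.smulRight_apply, hψ, one_smul] at hz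
  rw [hz]
  exact Submodule.sum_mem _ fun i _ => Submodule.subset_span ⟨_, rfl⟩

/-- If `QDerKS μ` is everything and `μ ≠ 0`, then every linear map is a second component. -/
lemma exists_left [FiniteDimensional F L] {μ : Bracket F L n} (hμ : QDerKS μ = ⊤) (h0 : μ ≠ 0)
    (f : End F L) :
    ∃ d : End F L, ∀ a, d (μ a) = ∑ i, μ (Function.update a i (f (a i))) := by
  have hspan := span_range_eq_top hμ h0
  have hfst : Function.Surjective ((LinearMap.fst F (End F L) (End F L)).domRestrict (QDer μ)) := by
    intro d
    obtain ⟨f, hf⟩ := QDerKS_eq_top_iff.1 hμ d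
    exact ⟨⟨(d, f), hf⟩, rfl⟩
  have hsnd : Function.Injective ((LinearMap.snd F (End F L) (End F L)).domRestrict (QDer μ)) := by
    rw [← LinearMap.ker_eq_bot, LinearMap.ker_eq_bot']
    rintro ⟨⟨d, f⟩, h⟩ hf
    have hf : f = 0 := hf
    subst hf
    have hd : d = 0 := by
      refine LinearMap.ext_on_range hspan fun a => ?_
      have : d (μ a) = ∑ i, μ (Function.update a i ((0 : End F L) (a i))) := h a
      simpa using this
    subst hd
    rfl
  -- The two projections give `dim End ≤ dim QDer ≤ dim End`, so the injective one is onto.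
  have h1 := LinearMap.finrank_le_finrank_of_injective hsnd
  have h2 := LinearMap.finrank_le_finrank_of_surjective hfst
  have h3 := (LinearMap.injective_iff_surjective_of_finrank_eq_finrank (le_antisymm h1 h2)).1 hsnd
  obtain ⟨⟨⟨d, f'⟩, h⟩, hf⟩ := h3 f
  have hf : f' = f := hf
  subst hf
  exact ⟨d, h⟩

/-- Distinct weights of nonzero products of basis vectors are bounded in number by `dim L`. -/
lemma card_le_of_weights [FiniteDimensional F L] {μ : Bracket F L n} (hμ : QDerKS μ = ⊤)
    (h0 : μ ≠ 0)
    {m : ℕ} (e : Basis (Fin m) F L) {ι : Type*} [Fintype ι] (v : ι → Fin n → Fin m)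
    (c : Fin m → F) (hv : ∀ i, μ (fun k => e (v i k)) ≠ 0)
    (hc : Function.Injective fun i => ∑ k, c (v i k)) : Fintype.card ι ≤ m := by
  obtain ⟨d, hd⟩ := exists_left hμ h0 (e.constr F fun i => c i • e i)
  -- A diagonal `f` makes each product of basis vectors an eigenvector of `d`, with the sum of the
  -- entries' weights as eigenvalue.
  have hli := Module.End.eigenvectors_linearIndependent' d (fun i => ∑ k, c (v i k)) hc
    (fun i => μ fun k => e (v i k)) (fun i => by
      refine ⟨?_, hv i⟩
      rw [Module.End.mem_eigenspace_iff, hd, Finset.sum_smul]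
      refine Finset.sum_congr rfl fun k _ => ?_
      rw [Basis.constr_basis, MultilinearMap.map_update_smul, Function.update_eq_self])
  have := hli.fintype_card_le_finrank
  rwa [Module.finrank_eq_card_basis e, Fintype.card_fin] at this

/-- The quasiderivation whose second component is the matrix unit `e s ↦ e t`. -/
lemma exists_matrixUnit [FiniteDimensional F L] {μ : Bracket F L n} (hμ : QDerKS μ = ⊤)
    (h0 : μ ≠ 0) {m : ℕ} (e : Basis (Fin m) F L) (s t : Fin m) :
    ∃ d : End F L, ∀ v : Fin n → Fin m, d (μ fun k => e (v k)) =
      ∑ k with v k = s, μ fun j => e (Function.update v k t j) := by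
  obtain ⟨d, hd⟩ := exists_left hμ h0 (e.constr F fun i => if i = s then e t else 0)
  refine ⟨d, fun v => ?_⟩
  rw [hd, Finset.sum_filter]
  refine Finset.sum_congr rfl fun k _ => ?_
  rw [Basis.constr_basis, comp_update_apply]
  split_ifs with h
  · rfl
  · exact μ.map_coord_zero k (by simp)

end General

/-! ### Commutative algebras -/

section Commutative

variable {F : Type*} [Field F] {L : Type*} [AddCommGroup L] [Module F L] {n : ℕ}

lemma IsCommutative.update_eq {μ : Bracket F L n} (hμ : IsCommutative μ) {α : Type*} (e : α → L)
    (v : Fin n → α) (t : α) {k l : Fin n} (h : v k = v l) :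
    (μ fun j => e (Function.update v k t j)) = μ fun j => e (Function.update v l t j) := by
  rw [← hμ (Equiv.swap k l)]
  congr 1
  ext j
  congr 1
  simp only [Function.update_apply]
  by_cases hk : j = k
  · subst hk
    rw [Equiv.swap_apply_left]
    by_cases hl : l = j
    · simp [hl]
    · simp [hl, Ne.symm hl, h]
  · by_cases hl : j = l
    · subst hl
      simp
    · rw [Equiv.swap_apply_of_ne_of_ne hk hl, if_neg hk, if_neg hl]

variable [CharZero F] [FiniteDimensional F L]

/-- The matrix unit `e (v k) ↦ e t` produces equal terms, one for each occurrence of `v k` in `v`;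
their number is nonzero in characteristic 0. -/
lemma IsCommutative.update_eq_zero {μ : Bracket F L n} (hμ : IsCommutative μ)
    (hq : QDerKS μ = ⊤) (h0 : μ ≠ 0) {m : ℕ} (e : Basis (Fin m) F L) {v : Fin n → Fin m}
    (hv : (μ fun k => e (v k)) = 0) (k : Fin n) (t : Fin m) :
    (μ fun j => e (Function.update v k t j)) = 0 := by
  obtain ⟨d, hd⟩ := exists_matrixUnit hq h0 e (v k) t
  have h := hd v
  rw [hv, map_zero, Finset.sum_congr rfl fun l hl =>
    hμ.update_eq e v t (Finset.mem_filter.1 hl).2, Finset.sum_const, eq_comm,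
    ← Nat.cast_smul_eq_nsmul F, smul_eq_zero] at h
  refine h.resolve_left (Nat.cast_ne_zero.2 (Finset.card_ne_zero.2 ⟨k, ?_⟩))
  simp

lemma IsCommutative.basis_ne_zero {μ : Bracket F L n} (hμ : IsCommutative μ)
    (hq : QDerKS μ = ⊤) (h0 : μ ≠ 0) {m : ℕ} (e : Basis (Fin m) F L) (v : Fin n → Fin m) :
    (μ fun k => e (v k)) ≠ 0 := by
  intro hv
  refine h0 (Basis.ext_multilinear (fun _ => e) fun w => ?_)
  have key : ∀ s : Finset (Fin n), (μ fun k => e (s.piecewise w v k)) = 0 := by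
    intro s
    induction s using Finset.induction_on with
    | empty => simpa using hv
    | insert k s _ ih =>
      rw [Finset.piecewise_insert]
      exact hμ.update_eq_zero hq h0 e ih k _
  simpa using key Finset.univ

lemma IsCommutative.finrank_eq_one {μ : Bracket F L n} (hn : 2 ≤ n) (hμ : IsCommutative μ)
    (hq : QDerKS μ = ⊤) (h0 : μ ≠ 0) : finrank F L = 1 := by
  let e := finBasis F L
  have hpos : 0 < finrank F L := by
    by_contra! h
    have : Subsingleton L := finrank_zero_iff.1 (Nat.le_zero.1 h)
    exact h0 (MultilinearMap.ext fun x => Subsingleton.elim _ _)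
  by_contra hne
  have h2 : 1 < finrank F L := by omega
  let i0 : Fin (finrank F L) := ⟨0, hpos⟩
  let i1 : Fin (finrank F L) := ⟨1, h2⟩
  let k0 : Fin n := ⟨0, by omega⟩
  -- The constant tuples have weights `n * i` and the tuple `(1, 0, …, 0)` has weight 1, not a
  -- multiple of `n ≥ 2`: one weight more than the dimension allows.
  let v : Option (Fin (finrank F L)) → Fin n → Fin (finrank F L) := fun o =>
    o.elim (Function.update (fun _ => i0) k0 i1) (fun i _ => i)
  have hw : ∀ o, ∑ k, ((v o k : ℕ) : F) = ((o.elim 1 fun i => n * (i : ℕ) : ℕ) : F) := by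
    rintro (_ | i)
    · rw [Finset.sum_eq_single k0]
      · simp [v, i1]
      · intro b _ hb
        simp [v, hb, i0]
      · simp
    · simp [v]
  have := card_le_of_weights hq h0 e v (fun i => ((i : ℕ) : F))
    (fun o => hμ.basis_ne_zero hq h0 e _) (by
      intro o o' h
      simp only [hw, Nat.cast_inj] at h
      rcases o with _ | i <;> rcases o' with _ | j
      · rfl
      · have := Nat.eq_one_of_mul_eq_one_right h.symm
        omega
      · have := Nat.eq_one_of_mul_eq_one_right h
        omega
      · have : (i : ℕ) = j := Nat.eq_of_mul_eq_mul_left (by omega) h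
        rw [Fin.ext this])
  simp at this

omit [CharZero F] in
lemma bracket_field_eq_LAlpha (ν : Bracket F F n) : ν = LAlpha n (ν fun _ => 1) := by
  refine MultilinearMap.ext fun x => ?_
  have := ν.map_smul_univ x (fun _ => 1)
  simpa [LAlpha, mul_comm] using this

omit [CharZero F] in
lemma LAlpha_apply (α : F) (x : Fin n → F) : LAlpha n α x = α * ∏ i, x i := by
  simp [LAlpha]

lemma QDerKS_LAlpha (hn : n ≠ 0) (α : F) : QDerKS (LAlpha n α) = ⊤ := by
  rw [QDerKS_eq_top_iff]
  intro d
  refine ⟨(n : F)⁻¹ • d, fun a => ?_⟩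
  have hd : ∀ x, d x = d 1 * x := fun x => by
    conv_lhs => rw [← mul_one x, ← smul_eq_mul, map_smul, smul_eq_mul, mul_comm]
  have hn' : (n : F) ≠ 0 := Nat.cast_ne_zero.2 hn
  have : ∀ i, LAlpha n α (Function.update a i (((n : F)⁻¹ • d) (a i))) =
      (n : F)⁻¹ * d 1 * LAlpha n α a := by
    intro i
    rw [LinearMap.smul_apply, hd, ← smul_eq_mul (d 1), smul_smul, smul_eq_mul,
      ← smul_eq_mul, MultilinearMap.map_update_smul, Function.update_eq_self, smul_eq_mul]
  rw [Finset.sum_congr rfl fun i _ => this i, hd, Finset.sum_const, Finset.card_univ, Fintype.card_fin,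
    nsmul_eq_mul, mul_assoc, mul_inv_cancel_left₀ hn']

theorem IsCommutative.QDerKS_eq_top_iff (hn : 2 ≤ n) {μ : Bracket F L n} (hμ : IsCommutative μ) :
    QDerKS μ = ⊤ ↔ μ = 0 ∨ ∃ α : F, α ≠ 0 ∧ Iso μ (LAlpha n α) := by
  constructor
  · intro hq
    by_cases h0 : μ = 0
    · exact Or.inl h0
    refine Or.inr ?_
    obtain ⟨ν, hν⟩ := exists_iso μ
      (LinearEquiv.ofFinrankEq L F (by rw [hμ.finrank_eq_one hn hq h0, finrank_self]))
    rw [bracket_field_eq_LAlpha ν] at hν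
    refine ⟨_, fun hα => h0 ?_, hν⟩
    rw [hα] at hν
    obtain ⟨φ, hφ⟩ := hν
    ext x
    exact φ.injective (by rw [hφ]; simp [LAlpha])
  · rintro (rfl | ⟨α, -, h⟩)
    · exact QDerKS_zero
    · exact h.symm.QDerKS_eq_top (QDerKS_LAlpha (by omega) α)

omit [CharZero F] [FiniteDimensional F L] in
lemma map_leftProd {m : L →ₗ[F] L →ₗ[F] L} {φ : L → F} (h : ∀ x y, φ (m x y) = φ x * φ y)
    {l : List L} (hl : l ≠ []) : φ (leftProd m l) = (l.map φ).prod := by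
  obtain ⟨a, l, rfl⟩ := List.exists_cons_of_ne_nil hl
  simp only [leftProd, List.map_cons, List.prod_cons]
  clear hl
  induction l generalizing a with
  | nil => simp
  | cons b l ih => simp [ih, h, mul_assoc]

theorem IsCommutative.exists_field_mul (hn : 2 ≤ n) {μ : Bracket F L n} (hμ : IsCommutative μ)
    (hq : QDerKS μ = ⊤) (h0 : μ ≠ 0) [IsAlgClosed F] :
    ∃ (m : L →ₗ[F] L →ₗ[F] L) (φ : L ≃ₗ[F] F),
      (∀ x y : L, φ (m x y) = φ x * φ y) ∧
      ∀ x : Fin n → L, μ x = leftProd m (List.ofFn x) := by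
  obtain ⟨α, hα, ψ, hψ⟩ := ((hμ.QDerKS_eq_top_iff hn).1 hq).resolve_left h0
  -- Rescaling `ψ` by `c` absorbs `α`, since `c * α = c ^ n`.
  obtain ⟨c, hc⟩ := IsAlgClosed.exists_pow_nat_eq α (n := n - 1) (by omega)
  have hc0 : c ≠ 0 := by
    rintro rfl
    exact hα (by rw [← hc, zero_pow (by omega)])
  let φ : L ≃ₗ[F] F := ψ.trans (LinearEquiv.smulOfNeZero F F c hc0)
  have hφ : ∀ x, φ x = c * ψ x := fun x => rfl
  let m : L →ₗ[F] L →ₗ[F] L :=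
    ((LinearMap.mul F F).compl₁₂ φ.toLinearMap φ.toLinearMap).compr₂ φ.symm.toLinearMap
  have hm : ∀ x y, φ (m x y) = φ x * φ y := fun x y => by simp [m]
  refine ⟨m, φ, hm, fun x => φ.injective ?_⟩
  rw [map_leftProd hm (by simp; omega), List.map_ofFn, List.prod_ofFn, hφ, hψ, LAlpha_apply, ← hc]
  simp only [Function.comp_apply, hφ, Finset.prod_mul_distrib, Finset.prod_const,
    Finset.card_univ, Fintype.card_fin]
  rw [← mul_assoc, mul_pow_sub_one (by omega)]

end Commutative

/-! ### Counting and reordering index tuples -/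

lemma exists_perm_of_range_subset {ι α : Type*} [Finite ι] {v w : ι → α}
    (hw : Function.Injective w) (h : Set.range w ⊆ Set.range v) :
    ∃ σ : Equiv.Perm ι, ∀ k, w k = v (σ k) := by
  choose σ hσ using fun k => h ⟨k, rfl⟩
  have hinj : Function.Injective σ := fun a b hab => hw (by rw [← hσ a, ← hσ b, hab])
  exact ⟨Equiv.ofBijective σ (Finite.injective_iff_bijective.1 hinj), fun k => (hσ k).symm⟩

/-- In dimension at least `n + 2` there would be more `n`-subsets of a basis than the weight bound
permits. -/
lemma lt_choose_of_two_le {n m : ℕ} (hn : 2 ≤ n) (hm : n + 2 ≤ m) : m < m.choose n := by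
  induction m, hm using Nat.le_induction with
  | base =>
    rw [Nat.choose_symm_add, Nat.choose_two_right, Nat.lt_div_iff_mul_lt' (by
      exact (Nat.even_mul_pred_self _).two_dvd)]
    have : n + 2 - 1 = n + 1 := rfl
    rw [this]
    nlinarith
  | succ m hm ih =>
    obtain ⟨n, rfl⟩ : ∃ k, n = k + 1 := ⟨n - 1, by omega⟩
    rw [Nat.choose_succ_succ']
    have := Nat.choose_pos (n := m) (k := n) (by omega)
    omega

/-! ### Anticommutative algebras: the dimension is `n + 1` -/

section Anticommutative

variable {F : Type*} [Field F] {L : Type*} [AddCommGroup L] [Module F L] {n : ℕ}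

lemma IsAnticommutative.perm_eq_zero {μ : Bracket F L n} (hμ : IsAnticommutative μ)
    {x : Fin n → L} (h : μ x = 0) (σ : Equiv.Perm (Fin n)) : μ (fun i => x (σ i)) = 0 := by
  rw [hμ, h, smul_zero]

lemma isAnticommutative_alternatingMap (g : L [⋀^Fin n]→ₗ[F] L) :
    IsAnticommutative g.toMultilinearMap := fun σ x => by
  exact g.map_perm x σ

variable [CharZero F]

/-- An anticommutative product, as an alternating map. -/
def IsAnticommutative.toAlternatingMap {μ : Bracket F L n} (hμ : IsAnticommutative μ) :
    L [⋀^Fin n]→ₗ[F] L :=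
  { μ with
    map_eq_zero_of_eq' := fun x i j hx hij => by
      have h := hμ (Equiv.swap i j) x
      rw [Equiv.Perm.sign_swap hij] at h
      have hs : (fun k => x (Equiv.swap i j k)) = x := by
        ext k
        rw [Equiv.swap_apply_def]
        split_ifs with h1 h2
        · rw [h1, hx]
        · rw [h2, hx]
        · rfl
      rw [hs] at h
      simp only [Units.val_neg, Units.val_one, neg_smul, one_smul] at h
      rw [eq_neg_iff_add_eq_zero, ← two_smul F, smul_eq_zero] at h
      exact h.resolve_left two_ne_zero }

/-- Anticommutative products that agree on families of distinct basis vectors up to order. -/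
lemma IsAnticommutative.ext_basis {μ ν : Bracket F L n} (hμ : IsAnticommutative μ)
    (hν : IsAnticommutative ν) {ι : Type*} (e : Basis ι F L)
    (h : ∀ v : Fin n → ι, Function.Injective v → μ (fun k => e (v k)) = ν fun k => e (v k)) :
    μ = ν := by
  have : hμ.toAlternatingMap = hν.toAlternatingMap := e.ext_alternating h
  exact MultilinearMap.ext fun x => DFunLike.congr_fun this x

variable [FiniteDimensional F L]

lemma IsAnticommutative.basis_ne_zero {μ : Bracket F L n} (hμ : IsAnticommutative μ)
    (hq : QDerKS μ = ⊤) (h0 : μ ≠ 0) {m : ℕ} (e : Basis (Fin m) F L) {v : Fin n → Fin m}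
    (hv : Function.Injective v) : (μ fun k => e (v k)) ≠ 0 := by
  intro hz
  -- Induction on the number of indices of `w` outside `v`; exchanging one of them for an index of
  -- `v` not in `w` lowers it.
  have key : ∀ N, ∀ w : Fin n → Fin m, Function.Injective w →
      (Finset.univ.image w \ Finset.univ.image v).card = N → (μ fun k => e (w k)) = 0 := by
    intro N
    induction N with
    | zero =>
      intro w hw hN
      obtain ⟨σ, hσ⟩ := exists_perm_of_range_subset (v := v) hw (by
        rw [Finset.card_eq_zero, Finset.sdiff_eq_empty_iff_subset] at hN
        simpa [← Finset.coe_subset] using hN)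
      simp only [hσ]
      exact hμ.perm_eq_zero hz σ
    | succ N ih =>
      intro w hw hN
      have hcard : (Finset.univ.image v \ Finset.univ.image w).card = N + 1 := by
        rw [← hN]
        apply Finset.card_sdiff_comm
        rw [Finset.card_image_of_injective _ hv, Finset.card_image_of_injective _ hw]
      obtain ⟨t, ht⟩ := Finset.card_pos.1 (by rw [hN]; exact Nat.succ_pos N)
      obtain ⟨s, hs⟩ := Finset.card_pos.1 (by rw [hcard]; exact Nat.succ_pos N)
      simp only [Finset.mem_sdiff, Finset.mem_image, Finset.mem_univ, true_and, not_exists] at ht hs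
      obtain ⟨⟨k, rfl⟩, ht⟩ := ht
      have hw' : Function.Injective (Function.update w k s) := by
        intro a b hab
        by_cases ha : a = k <;> by_cases hb : b = k
        · rw [ha, hb]
        · subst ha
          rw [Function.update_self, Function.update_of_ne hb] at hab
          exact absurd hab.symm (hs.2 b)
        · subst hb
          rw [Function.update_self, Function.update_of_ne ha] at hab
          exact absurd hab (hs.2 a)
        · rw [Function.update_of_ne ha, Function.update_of_ne hb] at hab
          exact hw hab
      have himg : Finset.univ.image (Function.update w k s) \ Finset.univ.image v =
          (Finset.univ.image w \ Finset.univ.image v).erase (w k) := by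
        obtain ⟨⟨l, rfl⟩, hs⟩ := hs
        ext a
        simp only [Finset.mem_sdiff, Finset.mem_image, Finset.mem_univ, true_and, not_exists,
          Finset.mem_erase]
        constructor
        · rintro ⟨⟨j, rfl⟩, hj⟩
          by_cases hjk : j = k
          · subst hjk
            exact absurd (by simp) (hj l)
          · rw [Function.update_of_ne hjk] at hj ⊢
            exact ⟨fun h => hjk (hw h), ⟨j, rfl⟩, hj⟩
        · rintro ⟨hne, ⟨j, rfl⟩, hj⟩
          exact ⟨⟨j, Function.update_of_ne (fun h => hne (by rw [h])) _ _⟩, hj⟩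
      have hz' := ih _ hw' (by
        rw [himg, Finset.card_erase_of_mem, hN, Nat.add_sub_cancel]
        simp only [Finset.mem_sdiff, Finset.mem_image, Finset.mem_univ, true_and, not_exists]
        exact ⟨⟨k, rfl⟩, ht⟩)
      -- The index `s` occurs exactly once in the exchanged tuple, so this matrix unit undoes the
      -- exchange with a single term.
      obtain ⟨d, hd⟩ := exists_matrixUnit hq h0 e s (w k)
      have h := hd (Function.update w k s)
      rw [hz', map_zero, Finset.sum_eq_single k] at h
      · simpa using h.symm
      · intro j hj hjk
        simp only [Finset.mem_filter, Finset.mem_univ, true_and] at hj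
        rw [Function.update_of_ne hjk] at hj
        exact absurd hj (hs.2 j)
      · simp
  refine h0 (hμ.ext_basis (ν := 0) (fun σ x => by simp) e fun w hw => ?_)
  rw [key _ w hw rfl]
  rfl

lemma IsAnticommutative.le_finrank {μ : Bracket F L n} (hμ : IsAnticommutative μ)
    (h0 : μ ≠ 0) : n ≤ finrank F L := by
  by_contra! h
  refine h0 (hμ.ext_basis (ν := 0) (fun σ x => by simp) (finBasis F L) fun w hw => ?_)
  have := Fintype.card_le_of_injective w hw
  simp only [Fintype.card_fin] at this
  omega

/-- In dimension `n` every product is a determinant times the product of the basis, so products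
cannot span. -/
lemma IsAnticommutative.finrank_ne {μ : Bracket F L n} (hn : 2 ≤ n) (hμ : IsAnticommutative μ)
    (hq : QDerKS μ = ⊤) (h0 : μ ≠ 0) : finrank F L ≠ n := by
  intro hm
  let e := (finBasis F L).reindex (finCongr hm)
  have hrange : Set.range μ ⊆ Submodule.span F {μ e} := by
    have hd : μ = (e.det.smulRight (μ e)).toMultilinearMap := by
      refine hμ.ext_basis (isAnticommutative_alternatingMap _) e fun w hw => ?_
      obtain ⟨σ, hσ⟩ := exists_perm_of_range_subset (v := id) hw (by simp)
      simp only [hσ, id_eq]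
      rw [hμ, isAnticommutative_alternatingMap]
      simp [e.det_self]
    rintro _ ⟨x, rfl⟩
    have hx : μ x = e.det x • μ e := DFunLike.congr_fun hd x
    rw [hx]
    exact Submodule.smul_mem _ _ (Submodule.mem_span_singleton_self _)
  have htop := span_range_eq_top hq h0
  have := Submodule.span_le.2 hrange
  rw [htop, top_le_iff] at this
  have h1 := finrank_span_le_card (R := F) ({μ e} : Set L)
  rw [this, finrank_top] at h1
  simp at h1
  omega

lemma IsAnticommutative.finrank_eq {μ : Bracket F L n} (hn : 2 ≤ n) (hμ : IsAnticommutative μ)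
    (hq : QDerKS μ = ⊤) (h0 : μ ≠ 0) : finrank F L = n + 1 := by
  have h1 := hμ.le_finrank h0
  have h2 := hμ.finrank_ne hn hq h0
  by_contra h3
  have hlt := lt_choose_of_two_le (m := finrank F L) hn (by omega)
  let ι := {S : Finset (Fin (finrank F L)) // S.card = n}
  -- By uniqueness of binary expansions, the weights `2 ^ i` separate the `n`-subsets.
  have h := card_le_of_weights hq h0 (finBasis F L)
    (fun (S : ι) => S.1.orderEmbOfFin S.2) (fun i => 2 ^ (i : ℕ))
    (fun S => hμ.basis_ne_zero hq h0 _ (S.1.orderEmbOfFin S.2).injective) (by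
      intro S T hST
      have hsum : ∀ S : ι, ∑ k, (2 : F) ^ (S.1.orderEmbOfFin S.2 k : ℕ) =
          ((∑ i ∈ S.1.map Fin.valEmbedding, 2 ^ i : ℕ) : F) := by
        rintro ⟨S, hS⟩
        rw [Finset.sum_map]
        have h := Finset.map_orderEmbOfFin_univ S hS
        generalize S.orderEmbOfFin hS = g at h
        subst h
        simp
      simp only [hsum, Nat.cast_inj] at hST
      exact Subtype.ext (Finset.map_injective _ (Finset.geomSum_injective le_rfl hST)))
  rw [Fintype.card_finset_len, Fintype.card_fin] at h
  omega

end Anticommutative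

open Matrix

/-! ### The cross product `D` and the algebras `L_B` -/

section CrossProduct

variable {F : Type*} [Field F] {n : ℕ}

lemma minor_apply (i : Fin (n + 1)) (x : Fin n → Fin (n + 1) → F) :
    minor n i x = (Matrix.of fun k l => x k (i.succAbove l)).det := rfl

lemma LB_apply (B : Matrix (Fin (n + 1)) (Fin (n + 1)) F) (x : Fin n → Fin (n + 1) → F) (j) :
    LB n B x j = ∑ i : Fin (n + 1), B j i * ((-1) ^ (n + (i : ℕ)) * minor n i x) := by
  simp only [LB, _root_.sum_apply, _root_.smul_apply,
    MultilinearMap.smulRight_apply, Finset.sum_apply, Pi.smul_apply, smul_eq_mul]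
  exact Finset.sum_congr rfl fun i _ => by ring

lemma D_apply (x : Fin n → Fin (n + 1) → F) (i : Fin (n + 1)) :
    D F n x i = (-1) ^ (n + (i : ℕ)) * minor n i x := by
  rw [D, LB_apply]
  simp [Matrix.one_apply]

lemma LB_eq_mulVec (B : Matrix (Fin (n + 1)) (Fin (n + 1)) F) (x : Fin n → Fin (n + 1) → F) :
    LB n B x = B *ᵥ D F n x := by
  ext j
  simp only [LB_apply, mulVec, dotProduct, D_apply]

/-- Laplace expansion along the first row. It characterizes `D`, so identities for `D` reduce to
identities for determinants. -/
lemma dotProduct_D (y : Fin (n + 1) → F) (x : Fin n → Fin (n + 1) → F) :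
    y ⬝ᵥ D F n x = (-1) ^ n * (Matrix.of (Fin.cons y x : Fin (n + 1) → _)).det := by
  rw [det_succ_row_zero, dotProduct, Finset.mul_sum]
  refine Finset.sum_congr rfl fun i _ => ?_
  rw [D_apply, minor_apply, pow_add]
  simp only [of_apply, Fin.cons_zero]
  have : (Matrix.of fun k l => x k (i.succAbove l)) =
      (Matrix.of (Fin.cons y x : Fin (n + 1) → Fin (n + 1) → F)).submatrix
        Fin.succ i.succAbove := by
    ext k l
    simp
  rw [this]
  ring

lemma isAnticommutative_LB (B : Matrix (Fin (n + 1)) (Fin (n + 1)) F) :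
    IsAnticommutative (LB n B) := by
  intro σ x
  ext j
  rw [Pi.smul_apply, LB_apply, LB_apply, Finset.smul_sum]
  refine Finset.sum_congr rfl fun i _ => ?_
  have : minor n i (fun k => x (σ k)) = (Equiv.Perm.sign σ : ℤ) • minor n i x :=
    (Matrix.detRowAlternating : (Fin n → F) [⋀^Fin n]→ₗ[F] F).map_perm
      (fun k => LinearMap.funLeft F F i.succAbove (x k)) σ
  rw [this, mul_smul_comm, mul_smul_comm]

/-- The trace rule for determinants: a matrix acting on the rows, one at a time. -/
lemma sum_det_updateRow {m : ℕ} (A M : Matrix (Fin m) (Fin m) F) :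
    ∑ i, (M.updateRow i (A *ᵥ M.row i)).det = A.trace * M.det := by
  -- Expansion along the replaced row, with cofactors read from the adjugate.
  have h : ∀ i, (M.updateRow i (A *ᵥ M.row i)).det = (M * Aᵀ * M.adjugate) i i := by
    intro i
    rw [← cramer_transpose_apply, cramer_eq_adjugate_mulVec, ← adjugate_transpose,
      mulVec_transpose, mul_apply]
    simp only [vecMul, dotProduct]
    refine Finset.sum_congr rfl fun j _ => ?_
    congr 1
    rw [mul_apply, mulVec, dotProduct]
    exact Finset.sum_congr rfl fun k _ => by rw [transpose_apply, mul_comm, row_apply]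
  calc ∑ i, (M.updateRow i (A *ᵥ M.row i)).det = (M * Aᵀ * M.adjugate).trace :=
        Finset.sum_congr rfl fun i _ => h i
    _ = A.trace * M.det := by
      rw [trace_mul_comm, ← mul_assoc, adjugate_mul, smul_mul, one_mul, trace_smul,
        trace_transpose, smul_eq_mul, mul_comm]

/-- After pairing with `y`, this is the trace rule for the rows `y, x₁, …, xₙ`; the term where `A`
hits `y` gives `Aᵀ`. -/
lemma sum_D_update (A : Matrix (Fin (n + 1)) (Fin (n + 1)) F) (x : Fin n → Fin (n + 1) → F) :
    ∑ i, D F n (Function.update x i (A *ᵥ x i)) = A.trace • D F n x - Aᵀ *ᵥ D F n x := by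
  refine dotProduct_eq _ _ fun y => ?_
  rw [dotProduct_comm, dotProduct_comm _ y, dotProduct_sum, dotProduct_sub, dotProduct_smul,
    dotProduct_mulVec, vecMul_transpose]
  simp only [dotProduct_D]
  have h := sum_det_updateRow A (Matrix.of (Fin.cons y x : Fin (n + 1) → Fin (n + 1) → F))
  rw [Fin.sum_univ_succ] at h
  have h0 : (Matrix.of (Fin.cons y x : Fin (n + 1) → Fin (n + 1) → F)).updateRow 0 (A *ᵥ y) =
      Matrix.of (Fin.cons (A *ᵥ y) x : Fin (n + 1) → Fin (n + 1) → F) :=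
    congrArg Matrix.of (Fin.update_cons_zero (α := fun _ => Fin (n + 1) → F) _ _ _)
  have h1 : ∀ i z, (Matrix.of (Fin.cons y x : Fin (n + 1) → Fin (n + 1) → F)).updateRow
      (Fin.succ i) z =
      Matrix.of (Fin.cons y (Function.update x i z) : Fin (n + 1) → Fin (n + 1) → F) :=
    fun i z => congrArg Matrix.of
      (Fin.cons_update (α := fun _ => Fin (n + 1) → F) _ _ _ _).symm
  have e0 : (Matrix.of (Fin.cons y x : Fin (n + 1) → Fin (n + 1) → F)).row 0 = y := rfl
  have e1 : ∀ i : Fin n,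
      (Matrix.of (Fin.cons y x : Fin (n + 1) → Fin (n + 1) → F)).row i.succ = x i :=
    fun i => rfl
  simp only [e0, e1, h0, h1] at h
  rw [← Finset.mul_sum, smul_eq_mul]
  linear_combination (-1) ^ n * h

lemma transpose_mulVec_D (A : Matrix (Fin (n + 1)) (Fin (n + 1)) F)
    (x : Fin n → Fin (n + 1) → F) :
    Aᵀ *ᵥ D F n (fun i => A *ᵥ x i) = A.det • D F n x := by
  refine dotProduct_eq _ _ fun y => ?_
  rw [dotProduct_comm, dotProduct_comm _ y, dotProduct_mulVec, vecMul_transpose, dotProduct_smul,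
    dotProduct_D, dotProduct_D]
  have : Matrix.of (Fin.cons (A *ᵥ y) fun i => A *ᵥ x i : Fin (n + 1) → Fin (n + 1) → F) =
      Matrix.of (Fin.cons y x : Fin (n + 1) → Fin (n + 1) → F) * Aᵀ := by
    ext i j
    rw [mul_apply]
    cases i using Fin.cases <;> simp [mulVec, dotProduct, mul_comm]
  rw [this, det_mul, det_transpose, smul_eq_mul]
  ring

lemma D_basis (i : Fin (n + 1)) :
    D F n (fun k => Pi.single (i.succAbove k) 1) = (-1 : F) ^ (n + (i : ℕ)) • Pi.single i 1 := by
  ext j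
  rw [D_apply, minor_apply]
  by_cases h : j = i
  · subst h
    have : (Matrix.of fun k l => (Pi.single (j.succAbove k) 1 : Fin (n + 1) → F) (j.succAbove l)) =
        1 := by
      ext k l
      simp [Pi.single_apply, one_apply, eq_comm]
    rw [this]
    simp
  · obtain ⟨k, rfl⟩ := Fin.exists_succAbove_eq h
    rw [det_eq_zero_of_row_eq_zero k]
    · simp
    · intro l
      simp

lemma mem_span_range_D (z : Fin (n + 1) → F) : z ∈ Submodule.span F (Set.range (D F n)) := by
  rw [← Finset.univ_sum_single z]
  refine Submodule.sum_mem _ fun i _ => ?_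
  have : (Pi.single i (z i) : Fin (n + 1) → F) =
      (z i * (-1) ^ (n + (i : ℕ))) • D F n (fun k => Pi.single (i.succAbove k) 1) := by
    rw [D_basis, smul_smul, mul_assoc, ← mul_pow]
    ext j
    simp [Pi.single_apply]
  rw [this]
  exact Submodule.smul_mem _ _ (Submodule.subset_span ⟨_, rfl⟩)

lemma span_range_D : Submodule.span F (Set.range (D F n)) = ⊤ :=
  Submodule.eq_top_iff'.2 mem_span_range_D

/-- A vector annihilated by every cross product with first entry `u` is zero. -/
lemma eq_zero_of_D_eq_zero [NeZero n] {u : Fin (n + 1) → F}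
    (h : ∀ y : Fin n → Fin (n + 1) → F, D F n (Function.update y 0 u) = 0) : u = 0 := by
  by_contra hu
  obtain ⟨l, hl⟩ := Function.ne_iff.1 hu
  -- The identity with row `l` replaced by `u` has determinant `u l ≠ 0`; the swap moves `u` to the
  -- row read as the first entry of `D`.
  let M : Matrix (Fin (n + 1)) (Fin (n + 1)) F :=
    ((1 : Matrix (Fin (n + 1)) (Fin (n + 1)) F).updateRow l u).submatrix
      (Equiv.swap (Fin.succ 0) l) id
  have hM : M.det ≠ 0 := by
    rw [det_permute, ← cramer_transpose_apply, transpose_one, cramer_one]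
    refine mul_ne_zero ?_ (by simpa using hl)
    rcases Int.units_eq_one_or (Equiv.Perm.sign (Equiv.swap (Fin.succ (0 : Fin n)) l)) with h | h
    all_goals
      rw [h]
      simp
  have hrow : Function.update (fun k : Fin n => M.row k.succ) 0 u = fun k => M.row k.succ := by
    rw [Function.update_eq_self_iff]
    ext j
    simp [M]
  have hcons : Matrix.of (Fin.cons (M.row 0) fun k : Fin n => M.row k.succ :
      Fin (n + 1) → Fin (n + 1) → F) = M := by
    ext i j
    cases i using Fin.cases <;> simp
  have := dotProduct_D (M.row 0) (fun k => M.row k.succ)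
  rw [hcons, ← hrow, h, dotProduct_zero, eq_comm, mul_eq_zero] at this
  exact this.elim (pow_ne_zero _ (neg_ne_zero.2 one_ne_zero)) hM

theorem QDerKS_LB [CharZero F] (hn : n ≠ 0) (B : Matrix (Fin (n + 1)) (Fin (n + 1)) F)
    (hB : B.det ≠ 0) : QDerKS (LB n B) = ⊤ := by
  rw [QDerKS_eq_top_iff]
  intro d
  have hB' : IsUnit B.det := hB.isUnit
  let E : Matrix (Fin (n + 1)) (Fin (n + 1)) F := B⁻¹ * LinearMap.toMatrix' d * B
  -- The solution of `tr A - Aᵀ = E`: taking traces in size `n + 1` forces `n * tr A = tr E`.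
  let A : Matrix (Fin (n + 1)) (Fin (n + 1)) F := ((n : F)⁻¹ * E.trace) • 1 - Eᵀ
  have hn' : (n : F) ≠ 0 := Nat.cast_ne_zero.2 hn
  have hA : A.trace = (n : F)⁻¹ * E.trace := by
    simp only [A, trace_sub, trace_smul, trace_one, trace_transpose, Fintype.card_fin, smul_eq_mul]
    push_cast
    field_simp
    ring
  refine ⟨Matrix.toLin' A, fun a => ?_⟩
  simp only [LB_eq_mulVec, toLin'_apply]
  rw [← mulVec_sum, sum_D_update, hA, ← LinearMap.toMatrix'_mulVec d, mulVec_mulVec]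
  have : (LinearMap.toMatrix' d) * B = B * E := by
    simp only [E, Matrix.mul_assoc, mul_nonsing_inv_cancel_left _ _ hB']
  rw [this, ← mulVec_mulVec]
  congr 1
  simp [A, sub_mulVec, smul_mulVec]

/-- An injective `n`-tuple of indices misses exactly one `i`, hence is a permutation of
`i.succAbove`; column `i` of `B` records that product. -/
lemma exists_eq_LB [CharZero F] {ν : Bracket F (Fin (n + 1) → F) n} (hν : IsAnticommutative ν) :
    ∃ B, ν = LB n B := by
  refine ⟨Matrix.of fun j i => (-1) ^ (n + (i : ℕ)) * ν (fun k => Pi.single (i.succAbove k) 1) j,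
    hν.ext_basis (isAnticommutative_LB _) (Pi.basisFun F _) fun v hv => ?_⟩
  obtain ⟨i, hi⟩ : ∃ i, i ∉ Set.range v := by
    by_contra! h
    simpa using Fintype.card_le_of_surjective v h
  obtain ⟨σ, hσ⟩ := exists_perm_of_range_subset (v := i.succAbove) hv (by
    rw [Fin.range_succAbove]
    rintro _ ⟨k, rfl⟩ rfl
    exact hi ⟨k, rfl⟩)
  simp only [hσ, Pi.basisFun_apply]
  have h1 := hν σ fun k => (Pi.single (i.succAbove k) 1 : Fin (n + 1) → F)
  have h2 := fun B => isAnticommutative_LB B σ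
    fun k => (Pi.single (i.succAbove k) 1 : Fin (n + 1) → F)
  rw [h1, h2, LB_eq_mulVec, D_basis, mulVec_smul, mulVec_single_one]
  congr 1
  ext j
  simp [← mul_assoc, ← mul_pow]

lemma det_ne_zero_of_QDerKS_eq_top {B : Matrix (Fin (n + 1)) (Fin (n + 1)) F}
    (hq : QDerKS (LB n B) = ⊤) (h0 : LB n B ≠ 0) : B.det ≠ 0 := by
  have hspan := span_range_eq_top hq h0
  have : LinearMap.range B.mulVecLin = ⊤ := by
    rw [← top_le_iff, ← hspan, Submodule.span_le]
    rintro _ ⟨x, rfl⟩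
    exact ⟨D F n x, (LB_eq_mulVec B x).symm⟩
  have hs : Function.Surjective B.mulVec := LinearMap.range_eq_top.1 this
  rw [← isUnit_iff_ne_zero, ← isUnit_iff_isUnit_det]
  exact mulVec_surjective_iff_isUnit.1 hs

theorem IsAnticommutative.QDerKS_eq_top_iff [CharZero F] {L : Type*} [AddCommGroup L] [Module F L]
    [FiniteDimensional F L] {μ : Bracket F L n} (hn : 2 ≤ n) (hμ : IsAnticommutative μ) :
    QDerKS μ = ⊤ ↔ μ = 0 ∨ ∃ B : Matrix (Fin (n + 1)) (Fin (n + 1)) F,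
      B.det ≠ 0 ∧ Iso μ (LB n B) := by
  constructor
  · intro hq
    by_cases h0 : μ = 0
    · exact Or.inl h0
    refine Or.inr ?_
    obtain ⟨ν, hν⟩ := exists_iso μ
      (LinearEquiv.ofFinrankEq L (Fin (n + 1) → F) (by
        rw [hμ.finrank_eq hn hq h0, finrank_fin_fun]))
    obtain ⟨B, rfl⟩ := exists_eq_LB (hν.isAnticommutative hμ)
    refine ⟨B, det_ne_zero_of_QDerKS_eq_top (hν.QDerKS_eq_top hq) fun hB => h0 ?_, hν⟩
    obtain ⟨φ, hφ⟩ := hν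
    ext x
    exact φ.injective (by rw [hφ, hB]; simp)
  · rintro (rfl | ⟨B, hB, h⟩)
    · exact QDerKS_zero
    · exact h.symm.QDerKS_eq_top (QDerKS_LB (by omega) B hB)

/-- All products lie on the line of `e₁`, so a `d` moving `e₁` off that line is no quasiderivation.
-/
theorem QDerKS_An_ne_top [NeZero n] (hn : 2 ≤ n) : QDerKS (An F n) ≠ ⊤ := by
  rw [Ne, NaryAlg.QDerKS_eq_top_iff]
  intro h
  let k1 : Fin n := ⟨1, by omega⟩
  have hk : k1 ≠ 0 := fun h => by simpa [k1] using congrArg Fin.val h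
  obtain ⟨f, hf⟩ := h (LinearMap.toSpanSingleton F (Fin n → F) (Pi.single k1 1) ∘ₗ
    LinearMap.proj 0)
  have h1 := congrFun (hf fun i => Pi.single i 1) k1
  have hA : ∀ x : Fin n → Fin n → F, An F n x = (Matrix.of x).det • Pi.single 0 1 := fun _ => rfl
  have hone : (Matrix.of fun i : Fin n => (Pi.single i 1 : Fin n → F)) = 1 := by
    ext i j
    simp [Pi.single_apply, one_apply, eq_comm]
  simp only [hA, Finset.sum_apply, Pi.smul_apply, Pi.single_eq_of_ne hk] at h1
  rw [hone] at h1
  simp at h1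

end CrossProduct

/-! ### Filippov algebras: symmetry of `B` and reduction to `D` -/

section Filippov

variable {F : Type*} [Field F] {n : ℕ}

lemma dotProduct_D_self (x : Fin n → Fin (n + 1) → F) (k : Fin n) : x k ⬝ᵥ D F n x = 0 := by
  rw [dotProduct_D, det_zero_of_row_eq (Fin.succ_ne_zero k), mul_zero]
  rfl

/-- The matrix of `z ↦ D (z, y₂, …, yₙ)`. -/
noncomputable def crossMatrix [NeZero n] (y : Fin n → Fin (n + 1) → F) :
    Matrix (Fin (n + 1)) (Fin (n + 1)) F :=
  LinearMap.toMatrix' ((D F n).toLinearMap y 0)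

lemma crossMatrix_mulVec [NeZero n] (y : Fin n → Fin (n + 1) → F) (z : Fin (n + 1) → F) :
    crossMatrix y *ᵥ z = D F n (Function.update y 0 z) := by
  rw [crossMatrix, LinearMap.toMatrix'_mulVec]
  rfl

lemma transpose_crossMatrix [NeZero n] (y : Fin n → Fin (n + 1) → F) :
    (crossMatrix y)ᵀ = -crossMatrix y := by
  have h : ∀ z, z ⬝ᵥ crossMatrix y *ᵥ z = 0 := fun z => by
    have := dotProduct_D_self (Function.update y 0 z) 0
    rwa [Function.update_self, ← crossMatrix_mulVec] at this
  ext i j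
  have h2 := h (Pi.single i 1 + Pi.single j 1)
  rw [mulVec_add, dotProduct_add, add_dotProduct, add_dotProduct, h, h] at h2
  simp only [mulVec_single_one, single_one_dotProduct, col_apply, zero_add, add_zero] at h2
  rw [transpose_apply, neg_apply]
  linear_combination h2

lemma vecMul_crossMatrix [NeZero n] (y : Fin n → Fin (n + 1) → F) {k : Fin n} (hk : k ≠ 0) :
    y k ᵥ* crossMatrix y = 0 := by
  refine dotProduct_eq_zero _ fun z => ?_
  rw [← dotProduct_mulVec, crossMatrix_mulVec]
  have := dotProduct_D_self (Function.update y 0 z) k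
  rwa [Function.update_of_ne hk] at this

/-- A nondegenerate `L_B` that is a Filippov algebra has a symmetric matrix `B`. -/
lemma transpose_eq_of_isFilippov [NeZero n] (hn : 2 ≤ n)
    {B : Matrix (Fin (n + 1)) (Fin (n + 1)) F} (hB : B.det ≠ 0) (h : IsFilippov (LB n B)) :
    Bᵀ = B := by
  have key : ∀ y : Fin n → Fin (n + 1) → F, crossMatrix y * (B - Bᵀ) = 0 := by
    intro y
    let R := crossMatrix y
    have hR : ∀ z, LB n B (Function.update y 0 z) = (B * R) *ᵥ z := fun z => by
      rw [LB_eq_mulVec, ← crossMatrix_mulVec, mulVec_mulVec]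
    -- The Filippov identity says that `B * R` is a derivation; compare both sides on the values of
    -- `D`, which span.
    have h1 : B * R * B = B * ((B * R).trace • 1 - (B * R)ᵀ) := by
      apply Matrix.toLin'.injective
      refine LinearMap.ext_on_range span_range_D fun x => ?_
      have := h.2 x y
      simp only [hR] at this
      simp only [LB_eq_mulVec] at this
      rw [← mulVec_sum, sum_D_update, mulVec_mulVec] at this
      rw [toLin'_apply, toLin'_apply, this, ← mulVec_mulVec, sub_mulVec, smul_mulVec, one_mulVec]
    rw [Matrix.mul_assoc] at h1
    have h2 : R * B = (B * R).trace • 1 - (B * R)ᵀ :=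
      ((isUnit_iff_isUnit_det B).2 hB.isUnit).mul_left_cancel h1
    -- Since `R` is skew, `(B * R)ᵀ = -R * Bᵀ`.
    have h3 : R * (B - Bᵀ) = (B * R).trace • 1 := by
      rw [transpose_mul, transpose_crossMatrix] at h2
      rw [mul_sub, h2, neg_mul]
      abel
    let k : Fin n := ⟨1, by omega⟩
    have hk : k ≠ 0 := fun h => by simpa [k] using congrArg Fin.val h
    -- The vector `y k` annihilates `R` from the left, so either the trace vanishes or `y k = 0`,
    -- and then `R = 0`.
    have h4 := congrArg (fun M => y k ᵥ* M) h3
    simp only [← vecMul_vecMul] at h4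
    rw [vecMul_crossMatrix y hk, zero_vecMul, vecMul_smul, vecMul_one, eq_comm, smul_eq_zero] at h4
    rcases h4 with h4 | h4
    · rw [h3, h4, zero_smul]
    · have : crossMatrix y = 0 := by
        refine Matrix.toLin'.injective (LinearMap.ext fun z => ?_)
        rw [toLin'_apply, crossMatrix_mulVec, map_zero, LinearMap.zero_apply]
        exact MultilinearMap.map_coord_zero _ k (by rw [Function.update_of_ne hk, h4])
      rw [this, zero_mul]
  have : B - Bᵀ = 0 := by
    refine Matrix.toLin'.injective (LinearMap.ext fun u => ?_)
    rw [map_zero, LinearMap.zero_apply, toLin'_apply]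
    refine eq_zero_of_D_eq_zero fun y => ?_
    rw [← crossMatrix_mulVec, mulVec_mulVec, key, zero_mulVec]
  exact (sub_eq_zero.1 this).symm

/-- A symmetric matrix over an algebraically closed field is of the form `Q Qᵀ`. -/
lemma exists_mul_transpose_eq [CharZero F] [IsAlgClosed F] {m : ℕ} {B : Matrix (Fin m) (Fin m) F}
    (hs : Bᵀ = B) : ∃ Q : Matrix (Fin m) (Fin m) F, Q * Qᵀ = B := by
  have : Invertible (2 : F) := invertibleOfNonzero two_ne_zero
  obtain ⟨v, hv⟩ := LinearMap.BilinForm.exists_orthogonal_basis (B := Matrix.toBilin' B)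
    ⟨fun x y => (isSymm_toBilin'_iff_isSymm.2 hs).eq x y⟩
  let w := v.reindex (finCongr (finrank_fin_fun F))
  let P : Matrix (Fin m) (Fin m) F := Matrix.of w
  have hP : IsUnit P.det := by
    have := (Pi.basisFun F (Fin m)).isUnit_det w
    rwa [Pi.basisFun_det_apply] at this
  have hd : ∃ c : Fin m → F, P * B * Pᵀ = diagonal c := by
    refine ⟨fun i => (P * B * Pᵀ) i i, ?_⟩
    ext i j
    by_cases hij : i = j
    · subst hij
      simp
    · rw [diagonal_apply_ne _ hij]
      have h := hv (i := finCongr (finrank_fin_fun F).symm i)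
        (j := finCongr (finrank_fin_fun F).symm j) (by simpa using hij)
      have h' : w i ⬝ᵥ B *ᵥ w j = 0 := by
        rw [← toBilin'_apply']
        simpa [w] using h
      rw [Matrix.mul_assoc]
      exact h'
  obtain ⟨c, hc⟩ := hd
  -- Square roots of the diagonal entries in an orthogonal basis give `Q`.
  choose r hr using fun i => IsAlgClosed.exists_eq_mul_self (c i)
  refine ⟨P⁻¹ * diagonal r, ?_⟩
  have hP' : IsUnit Pᵀ.det := by rwa [det_transpose]
  calc P⁻¹ * diagonal r * (P⁻¹ * diagonal r)ᵀ = P⁻¹ * (diagonal r * diagonal r) * Pᵀ⁻¹ := by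
        rw [transpose_mul, diagonal_transpose, transpose_nonsing_inv]
        simp only [Matrix.mul_assoc]
    _ = P⁻¹ * (P * B * Pᵀ) * Pᵀ⁻¹ := by
        rw [hc, diagonal_mul_diagonal]
        simp only [← hr]
    _ = B := by
        simp only [Matrix.mul_assoc, mul_nonsing_inv _ hP', Matrix.mul_one,
          nonsing_inv_mul_cancel_left _ _ hP]

/-- Apply `P` to `Pᵀ D(Px) = det P • D(x)` and cancel `det P`. -/
lemma iso_D_of_mul_transpose_eq {B P : Matrix (Fin (n + 1)) (Fin (n + 1)) F}
    (hP : P.det ≠ 0) (h : P * Pᵀ = P.det • B) : Iso (D F n) (LB n B) := by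
  refine ⟨LinearEquiv.ofIsUnitDet (f := Matrix.toLin' P) (v := Pi.basisFun F _)
    (v' := Pi.basisFun F _) (by simpa using hP), fun x => ?_⟩
  simp only [LinearEquiv.ofIsUnitDet_apply, toLin'_apply]
  have h1 := congrArg (P *ᵥ ·) (transpose_mulVec_D P x)
  simp only [mulVec_mulVec, h, mulVec_smul, smul_mulVec] at h1
  rw [LB_eq_mulVec]
  exact (smul_right_injective _ hP h1).symm

theorem IsFilippov.iso_D [CharZero F] [IsAlgClosed F] [NeZero n] (hn : 2 ≤ n)
    {B : Matrix (Fin (n + 1)) (Fin (n + 1)) F} (hB : B.det ≠ 0) (h : IsFilippov (LB n B)) :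
    Iso (LB n B) (D F n) := by
  obtain ⟨Q, hQ⟩ := exists_mul_transpose_eq (transpose_eq_of_isFilippov hn hB h)
  have hQ0 : Q.det ≠ 0 := by
    rintro h0
    rw [← hQ, det_mul, h0, zero_mul] at hB
    exact hB rfl
  -- This choice makes `det (c • Q) = c ^ (n + 1) * det Q = c ^ 2`, the factor by which `Q * Qᵀ` is
  -- scaled.
  obtain ⟨c, hc⟩ := IsAlgClosed.exists_pow_nat_eq Q.det⁻¹ (n := n - 1) (by omega)
  have hc0 : c ≠ 0 := by
    rintro rfl
    rw [zero_pow (by omega)] at hc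
    exact inv_ne_zero hQ0 hc.symm
  have hdet : (c • Q).det = c ^ 2 := by
    rw [det_smul, Fintype.card_fin, show c ^ (n + 1) = c ^ (2 + (n - 1)) by congr 1; omega, pow_add, hc, mul_assoc,
      inv_mul_cancel₀ hQ0, mul_one]
  refine (iso_D_of_mul_transpose_eq (P := c • Q) ?_ ?_).symm
  · rw [hdet]
    exact pow_ne_zero _ hc0
  · rw [hdet, transpose_smul, smul_mul, Matrix.mul_smul, hQ, smul_smul, sq]

end Filippov
end NaryAlg

theorem theorem4p9 {F : Type*} [Field F] [CharZero F] (n : ℕ) [NeZero n] (hn : 2 ≤ n)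
    {L : Type*} [AddCommGroup L] [Module F L] [FiniteDimensional F L]
    (μ : NaryAlg.Bracket F L n) :
    -- commutative algebras
    (NaryAlg.IsCommutative μ →
      (NaryAlg.QDerKS μ = ⊤ ↔ μ = 0 ∨ ∃ α : F, α ≠ 0 ∧ NaryAlg.Iso μ (NaryAlg.LAlpha n α)) ∧
      (NaryAlg.QDerKS μ = ⊤ → μ ≠ 0 → IsAlgClosed F →
        ∃ (m : L →ₗ[F] L →ₗ[F] L) (φ : L ≃ₗ[F] F),
          (∀ x y : L, φ (m x y) = φ x * φ y) ∧
          ∀ x : Fin n → L, μ x = NaryAlg.leftProd m (List.ofFn x))) ∧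
    -- anticommutative algebras
    (NaryAlg.IsAnticommutative μ →
      (NaryAlg.QDerKS μ = ⊤ ↔ μ = 0 ∨ ∃ B : Matrix (Fin (n + 1)) (Fin (n + 1)) F,
        B.det ≠ 0 ∧ NaryAlg.Iso μ (NaryAlg.LB n B)) ∧
      (NaryAlg.QDerKS μ = ⊤ → μ ≠ 0 → NaryAlg.IsFilippov μ → IsAlgClosed F →
        NaryAlg.Iso μ (NaryAlg.D F n))) ∧
    -- every nondegenerate `L_B` has the property, and `A_n` does not
    (∀ B : Matrix (Fin (n + 1)) (Fin (n + 1)) F, B.det ≠ 0 →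
      NaryAlg.QDerKS (NaryAlg.LB n B) = ⊤) ∧
    NaryAlg.QDerKS (NaryAlg.An F n) ≠ ⊤ := by
  refine ⟨fun hμ => ⟨hμ.QDerKS_eq_top_iff hn, fun hq h0 _ => hμ.exists_field_mul hn hq h0⟩,
    fun hμ => ⟨hμ.QDerKS_eq_top_iff hn, fun hq h0 hF _ => ?_⟩,
    fun B hB => NaryAlg.QDerKS_LB (by omega) B hB, NaryAlg.QDerKS_An_ne_top hn⟩
  obtain ⟨B, hB, hiso⟩ := ((hμ.QDerKS_eq_top_iff hn).1 hq).resolve_left h0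
  exact hiso.trans ((hiso.isFilippov hF).iso_D hn hB)
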